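/- Theorem (Gaussian correlation inequality). Let $n\ge n_1\ge 1$ be integers and let $X=(X_1,\dots,X_n)$ be a centered Gaussian random vector in $\mathbb{R}^n$ (its covariance matrix may be singular). Then $$\mathbb{P}\Big[\max_{1\le i\le n}|X_i|\le 1\Big]\ \ge\ \mathbb{P}\Big[\max_{1\le i\le n_1}|X_i|\le 1\Big]\cdot\mathbb{P}\Big[\max_{n_1<i\le n}|X_i|\le 1\Big],$$ where for $n_1=n$ the maximum over the empty index set is taken to be $0$, so that the last probability equals $1$. -/

import Mathlib

open MeasureTheory ProbabilityTheory

/-! ### Determinants along the interpolation that decouples the two blocks. -/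

section Determinants
open Matrix Finset
open scoped MatrixOrder Matrix.Norms.L2Operator

variable {ι : Type*}

/-! This is Royen's argument, with polynomials in place of densities. Scale the cross-covariances by
`τ`: `τ = 1` is the given vector, and `τ = 0` makes the two blocks independent. It suffices that the
expectation of `∏ i, p (exp (-κ x i ^ 2 / 2))` increases with `τ` on `[0, 1]` for polynomials `p`
that are nonnegative and nondecreasing there; such `p` approximate an indicator.

Expanding the product gives a finite combination of Laplace transforms `det (1 + diagonal l * S τ) ^
(-1/2)`. The determinant is `∑ J, (∏ i ∈ J, l i) * c J τ`, with `c J` the principal minors, so its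
power `-1/2` has derivative `-(1/2) * det ^ (-3/2) * ∑ J, (∏ i ∈ J, l i) * deriv (c J) τ`. Two facts
give the sign. The minors decrease in `τ`
(`Matrix.PosSemidef.principalMinor_offBlockScale_antitoneOn`). And `det ^ (-3/2)` is the Laplace
transform for three independent copies, while the factors `l i` turn `p` into `κ t p'(t)`, so the
coefficient of each `-(1/2) * deriv (c J) τ` is the expectation of a nonnegative function
(`sum_coeff_mul_laplace_cube_nonneg`). -/

/-- Multiply by `τ` the entries of `C` whose row and column lie on different sides of `p`. -/
def Matrix.offBlockScale (p : ι → Prop) [DecidablePred p] (C : Matrix ι ι ℝ) (τ : ℝ) :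
    Matrix ι ι ℝ :=
  Matrix.of fun i j => if (p i ↔ p j) then C i j else τ * C i j

variable (p : ι → Prop) [DecidablePred p]

theorem Matrix.offBlockScale_one (C : Matrix ι ι ℝ) : C.offBlockScale p 1 = C := by
  ext i j; simp [Matrix.offBlockScale]

variable [DecidableEq ι]

theorem Matrix.offBlockScale_add_smul_one (C : Matrix ι ι ℝ) (ε τ : ℝ) :
    (C + ε • 1).offBlockScale p τ = C.offBlockScale p τ + ε • 1 := by
  ext i j
  by_cases h : i = j
  · subst h; simp [Matrix.offBlockScale]
  · simp [Matrix.offBlockScale, h]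

variable [Fintype ι]

/-- The diagonal sign matrix of the splitting given by `p`. -/
def Matrix.blockSign : Matrix ι ι ℝ := Matrix.diagonal fun i => if p i then 1 else -1

/-- For `|τ| ≤ 1` this is a convex combination of `C` and a congruent copy, so positivity is
inherited. -/
theorem Matrix.offBlockScale_eq (C : Matrix ι ι ℝ) (τ : ℝ) :
    C.offBlockScale p τ =
      ((1 + τ) / 2) • C + ((1 - τ) / 2) • (blockSign p * C * (blockSign p)ᴴ) := by
  ext i j
  simp only [Matrix.offBlockScale, blockSign, diagonal_conjTranspose, of_apply, add_apply,
    smul_apply, mul_diagonal, diagonal_mul, smul_eq_mul, Pi.star_apply]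
  by_cases hi : p i <;> by_cases hj : p j <;> simp [hi, hj] <;> ring

theorem Matrix.blockSign_mul_self : blockSign p * blockSign p = 1 := by
  rw [blockSign, diagonal_mul_diagonal, ← diagonal_one]
  congr 1; ext i; by_cases hi : p i <;> simp [hi]

theorem Matrix.offBlockScale_neg (C : Matrix ι ι ℝ) (τ : ℝ) :
    C.offBlockScale p (-τ) = blockSign p * C.offBlockScale p τ * blockSign p := by
  ext i j
  simp only [Matrix.offBlockScale, blockSign, of_apply, mul_diagonal, diagonal_mul]
  by_cases hi : p i <;> by_cases hj : p j <;> simp [hi, hj]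

theorem Matrix.det_offBlockScale_neg (C : Matrix ι ι ℝ) (τ : ℝ) :
    (C.offBlockScale p (-τ)).det = (C.offBlockScale p τ).det := by
  rw [offBlockScale_neg, mul_assoc, det_mul_comm, mul_assoc, blockSign_mul_self, mul_one]

theorem Matrix.PosSemidef.offBlockScale {C : Matrix ι ι ℝ} (hC : C.PosSemidef) {τ : ℝ}
    (h₁ : -1 ≤ τ) (h₂ : τ ≤ 1) : (C.offBlockScale p τ).PosSemidef := by
  rw [offBlockScale_eq]
  exact (hC.smul (by linarith)).add ((hC.mul_mul_conjTranspose_same _).smul (by linarith))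

theorem Matrix.PosDef.offBlockScale {C : Matrix ι ι ℝ} (hC : C.PosDef) {τ : ℝ}
    (h₁ : -1 ≤ τ) (h₂ : τ ≤ 1) : (C.offBlockScale p τ).PosDef := by
  have hu : IsUnit (blockSign p) :=
    ⟨⟨_, _, blockSign_mul_self p, blockSign_mul_self p⟩, rfl⟩
  have hS : (blockSign p * C * (blockSign p)ᴴ).PosDef := by
    rwa [← star_eq_conjTranspose, Matrix.IsUnit.posDef_star_right_conjugate_iff hu]
  rw [offBlockScale_eq]
  rcases eq_or_lt_of_le h₁ with h | h
  · subst h; simpa using hS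
  · exact (hC.smul (by linarith)).add_posSemidef (hS.posSemidef.smul (by linarith))

theorem Matrix.IsHermitian.det_one_add_smul {B : Matrix ι ι ℝ} (hB : B.IsHermitian) (τ : ℝ) :
    (1 + τ • B).det = ∏ i, (1 + τ * hB.eigenvalues i) := by
  have h := hB.spectral_theorem
  set U := hB.eigenvectorUnitary
  set D : Matrix ι ι ℝ := diagonal (RCLike.ofReal ∘ hB.eigenvalues)
  rw [Unitary.conjStarAlgAut_apply] at h
  have hU : (U : Matrix ι ι ℝ) * star (U : Matrix ι ι ℝ) = 1 := Unitary.coe_mul_star_self U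
  have e : 1 + τ • B = (U : Matrix ι ι ℝ) * (1 + τ • D) * star (U : Matrix ι ι ℝ) := by
    rw [mul_add, add_mul, mul_one, hU, mul_smul_comm, smul_mul_assoc, ← h]
  have e₂ : 1 + τ • D = diagonal fun i => 1 + τ * hB.eigenvalues i := by
    ext i j
    by_cases hij : i = j
    · subst hij; simp [D]
    · simp [D, hij]
  rw [e, mul_assoc, det_mul_comm, mul_assoc, (Unitary.coe_star_mul_self U), mul_one, e₂,
    det_diagonal]

/-- With `A = Lᴴ * L`, the `b i` are the eigenvalues of `B` transported by `L⁻¹`. -/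
theorem Matrix.PosDef.exists_det_add_smul {A B : Matrix ι ι ℝ} (hA : A.PosDef)
    (hB : B.IsHermitian) :
    ∃ b : ι → ℝ, ∀ τ : ℝ, (A + τ • B).det = A.det * ∏ i, (1 + τ * b i) := by
  obtain ⟨L, hL, rfl⟩ : ∃ L : Matrix ι ι ℝ, IsUnit L ∧ A = Lᴴ * L := by
    obtain ⟨L, rfl⟩ := CStarAlgebra.nonneg_iff_eq_star_mul_self.1 hA.posSemidef.nonneg
    refine ⟨L, (isUnit_iff_isUnit_det _).2 (isUnit_iff_ne_zero.2 fun h => ?_), rfl⟩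
    have := hA.det_pos
    simp [det_mul, h] at this
  have hd : IsUnit L.det := (isUnit_iff_isUnit_det _).1 hL
  have hB' : ((L⁻¹)ᴴ * B * L⁻¹).IsHermitian := isHermitian_conjTranspose_mul_mul _ hB
  refine ⟨hB'.eigenvalues, fun τ => ?_⟩
  rw [← hB'.det_one_add_smul]
  have e : Lᴴ * L + τ • B = Lᴴ * (1 + τ • ((L⁻¹)ᴴ * B * L⁻¹)) * L := by
    have h₁ : Lᴴ * (L⁻¹)ᴴ = 1 := by
      rw [← conjTranspose_mul, nonsing_inv_mul _ hd, conjTranspose_one]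
    rw [mul_add, add_mul, mul_one, mul_smul_comm, smul_mul_assoc, ← mul_assoc, ← mul_assoc, h₁,
      one_mul, mul_assoc B, nonsing_inv_mul _ hd, mul_one]
  rw [e]; simp only [det_mul]; ring

/-- The determinant is a product of real linear factors in `τ`, is even in `τ`, and has no zero in
`[-1, 1]`. Its square is therefore a constant times a product of decreasing factors `1 - τ ^ 2 * b i
^ 2 ≥ 0`. -/
theorem Matrix.PosDef.det_offBlockScale_antitoneOn {C : Matrix ι ι ℝ} (hC : C.PosDef) :
    AntitoneOn (fun τ => (C.offBlockScale p τ).det) (Set.Icc 0 1) := by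
  have hC₀ : (C.offBlockScale p 0).PosDef := hC.offBlockScale p (by norm_num) (by norm_num)
  have hlin : ∀ τ, C.offBlockScale p τ =
      C.offBlockScale p 0 + τ • (C - C.offBlockScale p 0) := by
    intro τ; ext i j
    by_cases h : (p i ↔ p j) <;> simp [Matrix.offBlockScale, h]
  obtain ⟨b, hb⟩ := hC₀.exists_det_add_smul (hC.1.sub hC₀.1)
  have hdet : ∀ τ, (C.offBlockScale p τ).det =
      (C.offBlockScale p 0).det * ∏ i, (1 + τ * b i) := fun τ => by rw [hlin, hb]
  -- Otherwise `τ = -(b i)⁻¹` would be a zero of the determinant inside `[-1, 1]`.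
  have hb₁ : ∀ i, b i ^ 2 ≤ 1 := by
    intro i
    by_contra! h
    have hb0 : b i ≠ 0 := by rintro h0; simp [h0] at h; linarith
    have habs : |(-(b i)⁻¹)| ≤ 1 := by
      rw [abs_neg, abs_inv]
      exact inv_le_one_of_one_le₀ ((one_lt_sq_iff_one_lt_abs _).1 h).le
    have hp := (hC.offBlockScale p (abs_le.1 habs).1 (abs_le.1 habs).2).det_pos
    rw [hdet, Finset.prod_eq_zero (Finset.mem_univ i) (by field_simp; simp), mul_zero] at hp
    exact lt_irrefl _ hp
  -- By evenness, the square is the product of the values at `τ` and `-τ`.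
  have hsq : ∀ τ, (C.offBlockScale p τ).det ^ 2 =
      (C.offBlockScale p 0).det ^ 2 * ∏ i, (1 - τ ^ 2 * b i ^ 2) := by
    intro τ
    have : ∏ i, (1 - τ ^ 2 * b i ^ 2) = (∏ i, (1 + τ * b i)) * ∏ i, (1 + -τ * b i) := by
      rw [← Finset.prod_mul_distrib]; exact Finset.prod_congr rfl fun i _ => by ring
    rw [sq]
    nth_rw 2 [← det_offBlockScale_neg]
    rw [hdet, hdet (-τ), this]; ring
  intro s hs t ht hst
  have hs0 := (hC.offBlockScale p (by linarith [hs.1]) hs.2).det_pos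
  have ht0 := (hC.offBlockScale p (by linarith [ht.1]) ht.2).det_pos
  refine (sq_le_sq₀ ht0.le hs0.le).1 ?_
  rw [hsq t, hsq s]
  refine mul_le_mul_of_nonneg_left (Finset.prod_le_prod (fun i _ => ?_) fun i _ => ?_)
    (sq_nonneg (C.offBlockScale p 0).det)
  · have := mul_le_one₀ (pow_le_one₀ ht.1 ht.2 (n := 2)) (sq_nonneg (b i)) (hb₁ i)
    linarith
  · have h₂ : s ^ 2 ≤ t ^ 2 := pow_le_pow_left₀ hs.1 hst 2
    have := mul_le_mul_of_nonneg_right h₂ (sq_nonneg (b i))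
    linarith

theorem Matrix.PosSemidef.det_offBlockScale_antitoneOn {C : Matrix ι ι ℝ} (hC : C.PosSemidef) :
    AntitoneOn (fun τ => (C.offBlockScale p τ).det) (Set.Icc 0 1) := by
  intro s hs t ht hst
  have hlim : ∀ τ, Filter.Tendsto (fun ε : ℝ => ((C + ε • 1).offBlockScale p τ).det)
      (nhdsWithin 0 (Set.Ioi 0)) (nhds (C.offBlockScale p τ).det) := by
    intro τ
    have hc : Continuous fun ε : ℝ => ((C + ε • 1).offBlockScale p τ).det := by
      simp_rw [offBlockScale_add_smul_one]
      fun_prop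
    simpa using (hc.tendsto 0).mono_left nhdsWithin_le_nhds
  refine le_of_tendsto_of_tendsto (hlim t) (hlim s) ?_
  filter_upwards [self_mem_nhdsWithin] with ε hε
  exact (PosDef.posSemidef_add hC (Matrix.PosDef.one.smul hε)).det_offBlockScale_antitoneOn p
    hs ht hst

/-- The coefficient of `∏ i ∈ J, l i` in `det (1 + diagonal l * C)`. -/
def Matrix.principalMinor (C : Matrix ι ι ℝ) (J : Finset ι) : ℝ :=
  Matrix.det (Matrix.of (J.piecewise C (1 : Matrix ι ι ℝ)))

/-- Multilinearity in the rows: each row comes either from `diagonal l * C` or from the identity. -/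
theorem Matrix.det_one_add_diagonal_mul (C : Matrix ι ι ℝ) (l : ι → ℝ) :
    (1 + diagonal l * C).det = ∑ J : Finset ι, (∏ i ∈ J, l i) * C.principalMinor J := by
  have h := (Matrix.detRowAlternating (n := ι) (R := ℝ)).map_add_univ
    (fun i => l i • C i) (1 : Matrix ι ι ℝ)
  have e : (1 + diagonal l * C) = (of fun i => l i • C i) + 1 := by
    rw [add_comm]; ext i j; simp [diagonal_mul]
  rw [e]
  refine h.trans (Finset.sum_congr rfl fun J _ => ?_)
  rw [← smul_eq_mul]
  have e₂ : J.piecewise (fun i => l i • C i) (1 : Matrix ι ι ℝ) =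
      J.piecewise (fun i => l i • (J.piecewise C (1 : Matrix ι ι ℝ)) i) (J.piecewise C (1 : Matrix ι ι ℝ)) := by
    ext i j
    by_cases hi : i ∈ J <;> simp [Finset.piecewise, hi]
  rw [e₂]
  exact (Matrix.detRowAlternating (n := ι) (R := ℝ)).toMultilinearMap.map_piecewise_smul _ _ _

/-- The symmetric form is again positive semidefinite when `C` is, and it commutes with off-block
scaling, so determinant monotonicity applies to every minor. -/
theorem Matrix.principalMinor_eq (C : Matrix ι ι ℝ) (J : Finset ι) :
    C.principalMinor J =
      (diagonal (fun i => if i ∈ J then 1 else 0) * C * diagonal (fun i => if i ∈ J then 1 else 0) +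
        diagonal (fun i => if i ∈ J then 0 else 1)).det := by
  set D : Matrix ι ι ℝ := diagonal (fun i => if i ∈ J then 1 else 0)
  set D' : Matrix ι ι ℝ := diagonal (fun i => if i ∈ J then 0 else 1)
  have hD'D : D' * D = 0 := by
    simp only [D, D', diagonal_mul_diagonal]
    rw [← diagonal_zero]; congr 1; ext i; by_cases hi : i ∈ J <;> simp [hi]
  have hD'D' : D' * D' = D' := by
    simp only [D', diagonal_mul_diagonal]
    congr 1; ext i; by_cases hi : i ∈ J <;> simp [hi]
  have hadd : D + D' = 1 := by
    simp only [D, D', diagonal_add]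
    rw [← diagonal_one]; congr 1; ext i; by_cases hi : i ∈ J <;> simp [hi]
  -- The left factor has determinant `1`, since `D' * D = 0`.
  have e : of (J.piecewise C (1 : Matrix ι ι ℝ)) = (1 + (D * C) * D') * (D * C * D + D') := by
    calc of (J.piecewise C (1 : Matrix ι ι ℝ)) = D * C + D' := by
          ext i j
          by_cases hi : i ∈ J <;> simp [D, D', hi, Finset.piecewise, diagonal_mul, Matrix.one_apply,
            diagonal_apply]
      _ = D * C * (D + D') + D' := by rw [hadd, mul_one]
      _ = (D * C * D + D') + D * C * (D' * D) * C * D + D * C * (D' * D') := by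
          rw [hD'D, hD'D']; simp only [mul_add, mul_zero, zero_mul]; abel
      _ = _ := by noncomm_ring
  rw [principalMinor, e, det_mul, det_one_add_mul_comm, ← mul_assoc, hD'D, zero_mul, add_zero,
    det_one, one_mul]

theorem Matrix.PosSemidef.principalMinor_offBlockScale_antitoneOn {C : Matrix ι ι ℝ}
    (hC : C.PosSemidef) (J : Finset ι) :
    AntitoneOn (fun τ => (C.offBlockScale p τ).principalMinor J) (Set.Icc 0 1) := by
  set D : Matrix ι ι ℝ := diagonal (fun i => if i ∈ J then 1 else 0) with hD
  set D' : Matrix ι ι ℝ := diagonal (fun i => if i ∈ J then 0 else 1) with hD'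
  have hDh : Dᴴ = D := by simp [D]
  have hpsd : (D * C * D + D').PosSemidef := by
    have h := hC.mul_mul_conjTranspose_same D
    rw [hDh] at h
    refine h.add (PosSemidef.diagonal fun i => ?_)
    by_cases hi : i ∈ J <;> simp [hi]
  have e : ∀ τ, D * C.offBlockScale p τ * D + D' = (D * C * D + D').offBlockScale p τ := by
    intro τ; ext i j
    simp only [Matrix.offBlockScale, D, D', of_apply, add_apply, mul_diagonal, diagonal_mul,
      diagonal_apply]
    by_cases hij : i = j
    · subst hij; simp
    · by_cases h : (p i ↔ p j) <;> simp [h, hij]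
  simp_rw [principalMinor_eq, ← hD, ← hD', e]
  exact hpsd.det_offBlockScale_antitoneOn p

theorem Matrix.differentiable_principalMinor_offBlockScale (C : Matrix ι ι ℝ) (J : Finset ι) :
    Differentiable ℝ (fun τ => (C.offBlockScale p τ).principalMinor J) := by
  simp only [principalMinor, Matrix.det_apply]
  refine Differentiable.fun_sum fun σ _ => Differentiable.const_smul
    (Differentiable.fun_finsetProd fun i _ => ?_) _
  by_cases hi : σ i ∈ J <;> by_cases h : (p (σ i) ↔ p i) <;>
    simp [Finset.piecewise, hi, Matrix.offBlockScale, h]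

theorem Matrix.PosSemidef.deriv_principalMinor_offBlockScale_nonpos {C : Matrix ι ι ℝ}
    (hC : C.PosSemidef) (J : Finset ι) {τ : ℝ} (hτ : τ ∈ Set.Ioo (0 : ℝ) 1) :
    deriv (fun τ => (C.offBlockScale p τ).principalMinor J) τ ≤ 0 := by
  have hn : Set.Icc (0 : ℝ) 1 ∈ nhds τ := Icc_mem_nhds hτ.1 hτ.2
  rw [← derivWithin_of_mem_nhds hn]
  exact (hC.principalMinor_offBlockScale_antitoneOn p J).derivWithin_nonpos

end Determinants

/-! ### Laplace transforms of squared Gaussian coordinates. -/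

section Laplace
open Matrix WithLp
open scoped MatrixOrder

theorem ProbabilityTheory.integral_exp_neg_mul_sq_gaussianReal {d : ℝ} (hd : 0 ≤ d) :
    ∫ x, Real.exp (-(d * x ^ 2) / 2) ∂(gaussianReal 0 1) = (√(1 + d))⁻¹ := by
  rw [integral_gaussianReal_eq_integral_smul one_ne_zero]
  have : ∀ x : ℝ, gaussianPDFReal 0 1 x • Real.exp (-(d * x ^ 2) / 2) =
      (√(2 * Real.pi))⁻¹ * Real.exp (-((1 + d) / 2) * x ^ 2) := by
    intro x
    simp only [gaussianPDFReal, smul_eq_mul, mul_assoc, ← Real.exp_add]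
    simp only [NNReal.coe_one, mul_one, sub_zero]
    congr 2; ring
  simp_rw [this, integral_const_mul, integral_gaussian]
  rw [← Real.sqrt_inv, ← Real.sqrt_inv, ← Real.sqrt_mul (by positivity)]
  congr 1
  have := Real.pi_pos
  field_simp

variable {ι : Type*} [Fintype ι] [DecidableEq ι]

theorem Matrix.IsHermitian.dotProduct_mulVec_sum_eigenvectorBasis {T : Matrix ι ι ℝ}
    (hT : T.IsHermitian) (x : ι → ℝ) :
    ofLp (∑ i, x i • hT.eigenvectorBasis i) ⬝ᵥ T *ᵥ ofLp (∑ i, x i • hT.eigenvectorBasis i) =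
      ∑ i, hT.eigenvalues i * x i ^ 2 := by
  have h₁ : T *ᵥ ofLp (∑ i, x i • hT.eigenvectorBasis i) =
      ofLp (∑ i, (x i * hT.eigenvalues i) • hT.eigenvectorBasis i) := by
    simp only [ofLp_sum, ofLp_smul, mulVec_sum, mulVec_smul, hT.mulVec_eigenvectorBasis, smul_smul]
  have h₂ := hT.eigenvectorBasis.orthonormal.inner_sum (fun i => x i * hT.eigenvalues i) x Finset.univ
  rw [h₁]
  rw [EuclideanSpace.inner_eq_star_dotProduct] at h₂
  simp only [star_trivial] at h₂
  rw [h₂]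
  exact Finset.sum_congr rfl fun i _ => by simp; ring

/-- Rotation invariance: in an eigenbasis of `T` the integral splits into one-dimensional ones. -/
theorem ProbabilityTheory.integral_exp_neg_quadratic_stdGaussian {T : Matrix ι ι ℝ}
    (hT : T.PosSemidef) :
    ∫ x, Real.exp (-(ofLp x ⬝ᵥ T *ᵥ ofLp x) / 2) ∂(stdGaussian (EuclideanSpace ℝ ι)) =
      (√(1 + T).det)⁻¹ := by
  rw [stdGaussian_eq_map_pi_orthonormalBasis hT.1.eigenvectorBasis,
    integral_map (Measurable.aemeasurable (by fun_prop)) (by fun_prop)]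
  simp_rw [hT.1.dotProduct_mulVec_sum_eigenvectorBasis, ← Finset.sum_neg_distrib, Finset.sum_div,
    Real.exp_sum]
  rw [integral_fintype_prod_eq_prod (fun i x => Real.exp (-(hT.1.eigenvalues i * x ^ 2) / 2))]
  simp_rw [integral_exp_neg_mul_sq_gaussianReal (hT.eigenvalues_nonneg _)]
  have := hT.1.det_one_add_smul 1
  simp only [one_smul, one_mul] at this
  rw [this, Finset.prod_inv_distrib, Real.sqrt_prod]
  intro i _
  linarith [hT.eigenvalues_nonneg i]

/-- Joint Laplace transform of the squares of the coordinates of a centered Gaussian vector. -/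
theorem ProbabilityTheory.integral_exp_neg_sum_sq_multivariateGaussian {S : Matrix ι ι ℝ}
    (hS : S.PosSemidef) {l : ι → ℝ} (hl : ∀ i, 0 ≤ l i) :
    ∫ x, Real.exp (-(∑ i, l i * x i ^ 2) / 2) ∂(multivariateGaussian 0 S) =
      (√(1 + diagonal l * S).det)⁻¹ := by
  rw [multivariateGaussian, integral_map (by fun_prop) (by fun_prop)]
  set R := CFC.sqrt S
  have hR : Rᴴ = R := (CFC.sqrt_nonneg S).isSelfAdjoint
  have hRR : R * R = S := CFC.sqrt_mul_sqrt_self _ hS.nonneg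
  have hT : (R * diagonal l * R).PosSemidef := by
    have := (PosSemidef.diagonal hl).mul_mul_conjTranspose_same R
    rwa [hR] at this
  have e : ∀ x : EuclideanSpace ℝ ι,
      ∑ i, l i * ((0 : EuclideanSpace ℝ ι) + toEuclideanCLM (𝕜 := ℝ) R x) i ^ 2 =
        ofLp x ⬝ᵥ (R * diagonal l * R) *ᵥ ofLp x := by
    intro x
    rw [mul_assoc, ← mulVec_mulVec, ← mulVec_mulVec, dotProduct_mulVec, ← mulVec_transpose,
      ← conjTranspose_eq_transpose_of_trivial, hR]
    simp only [zero_add, dotProduct, mulVec_diagonal, ofLp_toEuclideanCLM]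
    exact Finset.sum_congr rfl fun i _ => by ring
  simp_rw [e]
  rw [integral_exp_neg_quadratic_stdGaussian hT, mul_assoc, det_one_add_mul_comm, mul_assoc, hRR]

theorem Matrix.PosSemidef.det_one_add_diagonal_mul_pos {S : Matrix ι ι ℝ}
    (hS : S.PosSemidef) {l : ι → ℝ} (hl : ∀ i, 0 ≤ l i) : 0 < (1 + diagonal l * S).det := by
  set R := CFC.sqrt S
  have hR : Rᴴ = R := (CFC.sqrt_nonneg S).isSelfAdjoint
  have hRR : R * R = S := CFC.sqrt_mul_sqrt_self _ hS.nonneg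
  have hT : (R * diagonal l * R).PosSemidef := by
    have := (PosSemidef.diagonal hl).mul_mul_conjTranspose_same R
    rwa [hR] at this
  rw [← hRR, ← mul_assoc, det_one_add_mul_comm, ← mul_assoc]
  exact (PosDef.one.add_posSemidef hT).det_pos
end Laplace

/-! ### Monotonicity of the interpolated expectation. -/

section Interpolation
open Matrix WithLp Polynomial

variable {ι : Type*} [Fintype ι]

theorem Real.prod_exp_neg_mul_pow {κ : ℝ} (y : ι → ℝ) (m : ι → ℕ) :
    ∏ i, Real.exp (-(κ * y i) / 2) ^ m i = Real.exp (-(∑ i, κ * m i * y i) / 2) := by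
  rw [← Finset.sum_neg_distrib, Finset.sum_div, Real.exp_sum]
  refine Finset.prod_congr rfl fun i _ => ?_
  rw [← Real.exp_nat_mul]; congr 1; ring

variable [DecidableEq ι]

theorem MeasureTheory.integral_prod_eval_polynomial {α : Type*} [MeasurableSpace α] (μ : Measure α)
    [IsFiniteMeasure μ] {q : ι → ℝ[X]} {N : ℕ} (hq : ∀ i, (q i).natDegree < N) {t : α → ι → ℝ}
    (ht : Measurable t) (h₀ : ∀ a i, 0 ≤ t a i) (h₁ : ∀ a i, t a i ≤ 1) :
    ∫ a, ∏ i, (q i).eval (t a i) ∂μ =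
      ∑ m ∈ Fintype.piFinset fun _ : ι => Finset.range N,
        (∏ i, (q i).coeff (m i)) * ∫ a, ∏ i, t a i ^ m i ∂μ := by
  have e : ∀ a, ∏ i, (q i).eval (t a i) =
      ∑ m ∈ Fintype.piFinset fun _ : ι => Finset.range N,
        (∏ i, (q i).coeff (m i)) * ∏ i, t a i ^ m i := by
    intro a
    simp_rw [fun i => eval_eq_sum_range' (hq i), Finset.prod_univ_sum, Finset.prod_mul_distrib]
  simp_rw [e]
  rw [integral_finsetSum]
  · simp_rw [integral_const_mul]
  · intro m _
    refine Integrable.const_mul (Integrable.of_bound (C := 1) (by fun_prop) ?_) _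
    refine Filter.Eventually.of_forall fun a => ?_
    have h0 : ∀ i ∈ Finset.univ, 0 ≤ t a i ^ m i := fun i _ => pow_nonneg (h₀ a i) _
    rw [Real.norm_of_nonneg (Finset.prod_nonneg h0)]
    exact Finset.prod_le_one h0 fun i _ => pow_le_one₀ (h₀ a i) (h₁ a i)

theorem Polynomial.coeff_X_mul_derivative (p : ℝ[X]) (m : ℕ) :
    (X * derivative p).coeff m = m * p.coeff m := by
  cases m with
  | zero => simp
  | succ m => rw [coeff_X_mul, coeff_derivative]; push_cast; ring

theorem Real.exp_neg_mul_div_two_le_one {κ y : ℝ} (hκ : 0 ≤ κ) (hy : 0 ≤ y) :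
    Real.exp (-(κ * y) / 2) ≤ 1 :=
  Real.exp_le_one_iff.2 (by have := mul_nonneg hκ hy; linarith)

/-- Positivity of the coefficient of `-(1/2) * deriv (principalMinor J)` in the derivative of the
interpolation: it is an expectation over the coordinatewise sums of the squares of three
independent copies of the Gaussian vector. -/
theorem ProbabilityTheory.sum_coeff_mul_laplace_cube_nonneg {S : Matrix ι ι ℝ} (hS : S.PosSemidef)
    {κ : ℝ} (hκ : 0 ≤ κ) {p : ℝ[X]} (hp : ∀ t ∈ Set.Icc (0 : ℝ) 1, 0 ≤ p.eval t)
    (hp' : ∀ t ∈ Set.Icc (0 : ℝ) 1, 0 ≤ (derivative p).eval t) (J : Finset ι) :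
    0 ≤ ∑ m ∈ Fintype.piFinset fun _ : ι => Finset.range (p.natDegree + 1),
      (∏ i, p.coeff (m i)) * (∏ i ∈ J, κ * m i) *
        (√(1 + diagonal (fun i => κ * m i) * S).det)⁻¹ ^ 3 := by
  set μ := multivariateGaussian 0 S
  -- `X * derivative` multiplies the `m`-th coefficient by `m`, which produces the factors `κ * m i`
  -- for `i ∈ J`.
  set q : ι → ℝ[X] := fun i => if i ∈ J then C κ * (X * derivative p) else p with hq
  have hqdeg : ∀ i, (q i).natDegree < p.natDegree + 1 := by
    intro i
    simp only [hq]
    split_ifs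
    · refine Nat.lt_succ_of_le (natDegree_le_iff_coeff_eq_zero.2 fun m hm => ?_)
      rw [coeff_C_mul, coeff_X_mul_derivative, coeff_eq_zero_of_natDegree_lt hm]; simp
    · exact Nat.lt_succ_self _
  let t : (Fin 3 → EuclideanSpace ℝ ι) → ι → ℝ :=
    fun ω i => Real.exp (-(κ * ∑ k, ω k i ^ 2) / 2)
  have ht₀ : ∀ ω i, 0 ≤ t ω i := fun ω i => (Real.exp_pos _).le
  have ht₁ : ∀ ω i, t ω i ≤ 1 := fun ω i =>
    Real.exp_neg_mul_div_two_le_one hκ (Finset.sum_nonneg fun k _ => sq_nonneg _)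
  have key := integral_prod_eval_polynomial (Measure.pi fun _ : Fin 3 => μ) hqdeg
    (t := t) (by fun_prop) ht₀ ht₁
  have hnonneg : 0 ≤ ∫ ω, ∏ i, (q i).eval (t ω i) ∂(Measure.pi fun _ : Fin 3 => μ) := by
    refine integral_nonneg fun ω => Finset.prod_nonneg fun i _ => ?_
    have hm : t ω i ∈ Set.Icc (0 : ℝ) 1 := ⟨ht₀ ω i, ht₁ ω i⟩
    simp only [hq]
    split_ifs
    · simp only [eval_mul, eval_C, eval_X]
      exact mul_nonneg hκ (mul_nonneg hm.1 (hp' _ hm))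
    · exact hp _ hm
  rw [key] at hnonneg
  refine hnonneg.trans_eq (Finset.sum_congr rfl fun m _ => ?_)
  have hcoeff : ∏ i, (q i).coeff (m i) = (∏ i, p.coeff (m i)) * ∏ i ∈ J, κ * m i := by
    rw [← Finset.prod_ite_mem_eq J (fun i => κ * (m i : ℝ)), ← Finset.prod_mul_distrib]
    refine Finset.prod_congr rfl fun i _ => ?_
    simp only [hq]
    split_ifs
    · rw [coeff_C_mul, coeff_X_mul_derivative]; ring
    · simp
  have hint : ∫ ω, ∏ i, t ω i ^ m i ∂(Measure.pi fun _ : Fin 3 => μ) =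
      (√(1 + diagonal (fun i => κ * m i) * S).det)⁻¹ ^ 3 := by
    rw [← integral_exp_neg_sum_sq_multivariateGaussian hS
      (l := fun i => κ * m i) (fun i => by positivity)]
    have := integral_fintype_prod_eq_pow (ι := Fin 3) (μ := μ)
      (fun x : EuclideanSpace ℝ ι => Real.exp (-(∑ i, κ * m i * x i ^ 2) / 2))
    rw [Fintype.card_fin] at this
    rw [← this]
    refine integral_congr_ae (Filter.Eventually.of_forall fun ω => ?_)
    simp only [t, Real.prod_exp_neg_mul_pow]
    rw [← Real.exp_sum]
    congr 1
    rw [← Finset.sum_div, Finset.sum_neg_distrib, Finset.sum_comm]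
    simp_rw [Finset.mul_sum]
  rw [hcoeff, hint]

/-- At `τ = 0` the matrix is block diagonal, so the determinant splits, and each factor sees only
one diagonal block of `S`. -/
theorem Matrix.det_one_add_diagonal_mul_offBlockScale_zero (P : ι → Prop) [DecidablePred P]
    (S : Matrix ι ι ℝ) (l : ι → ℝ) :
    (1 + diagonal l * S.offBlockScale P 0).det =
      (1 + diagonal (fun i => if P i then l i else 0) * S).det *
        (1 + diagonal (fun i => if P i then 0 else l i) * S).det := by
  have aux : ∀ (Q : ι → Prop) [DecidablePred Q], (∀ i j, Q i → Q j → (P i ↔ P j)) →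
      (1 + diagonal (fun i => if Q i then l i else 0) * S).det =
        (1 + diagonal (fun i => if Q i then l i else 0) * S.offBlockScale P 0).det := by
    intro Q _ hQ
    -- The extra projection can be moved to the right of `S` under the determinant, leaving only
    -- entries with row and column in `Q`, which scaling does not change.
    have hd : diagonal (fun i => if Q i then l i else 0) =
        diagonal (fun i => if Q i then 1 else 0) * diagonal (fun i => if Q i then l i else 0) := by
      rw [diagonal_mul_diagonal]; congr 1; ext i; split_ifs <;> simp
    rw [hd, mul_assoc, mul_assoc, det_one_add_mul_comm, det_one_add_mul_comm (diagonal _)]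
    congr 2
    ext i j
    simp only [mul_diagonal, diagonal_mul, Matrix.offBlockScale, of_apply]
    by_cases hi : Q i <;> by_cases hj : Q j <;> simp [hi, hj]
    exact fun h => absurd (hQ i j hi hj) h
  have h₁ := aux P fun i j hi hj => by simp [hi, hj]
  have h₂ := aux (fun i => ¬ P i) fun i j hi hj => by simp [hi, hj]
  simp only [ite_not] at h₂
  rw [h₁, h₂, ← det_mul]
  congr 1
  have hz : diagonal (fun i => if P i then l i else 0) * S.offBlockScale P 0 *
      diagonal (fun i => if P i then 0 else l i) = 0 := by
    ext i j
    simp only [mul_diagonal, diagonal_mul, Matrix.offBlockScale, of_apply]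
    by_cases hi : P i <;> by_cases hj : P j <;> simp [hi, hj]
  have hadd : diagonal l = diagonal (fun i => if P i then l i else 0) +
      diagonal (fun i => if P i then 0 else l i) := by
    rw [diagonal_add]; congr 1; ext i; split_ifs <;> simp
  rw [hadd, mul_add, mul_one, add_mul, add_mul, one_mul, ← mul_assoc, hz, zero_mul, add_zero,
    add_assoc]

/-- The cube here is what calls for three independent copies. -/
theorem hasDerivAt_inv_sqrt {f : ℝ → ℝ} {f' x : ℝ} (hf : HasDerivAt f f' x) (hx : 0 < f x) :
    HasDerivAt (fun y => (√(f y))⁻¹) (-(1 / 2) * f' * (√(f x))⁻¹ ^ 3) x := by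
  have hs := Real.sqrt_pos.2 hx
  convert! (hf.sqrt hx.ne').inv hs.ne' using 1
  field_simp

theorem ProbabilityTheory.integral_prod_eval_multivariateGaussian {S : Matrix ι ι ℝ}
    (hS : S.PosSemidef) {κ : ℝ} (hκ : 0 ≤ κ) (p : ℝ[X]) :
    ∫ x, ∏ i, p.eval (Real.exp (-(κ * x i ^ 2) / 2)) ∂(multivariateGaussian 0 S) =
      ∑ m ∈ Fintype.piFinset fun _ : ι => Finset.range (p.natDegree + 1),
        (∏ i, p.coeff (m i)) * (√(1 + diagonal (fun i => κ * m i) * S).det)⁻¹ := by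
  rw [integral_prod_eval_polynomial _ (q := fun _ => p) (N := p.natDegree + 1)
    (t := fun (x : EuclideanSpace ℝ ι) i => Real.exp (-(κ * x i ^ 2) / 2))
    (fun _ => Nat.lt_succ_self _) (by fun_prop) (fun _ _ => (Real.exp_pos _).le)
    (fun _ _ => Real.exp_neg_mul_div_two_le_one hκ (sq_nonneg _))]
  refine Finset.sum_congr rfl fun m _ => ?_
  simp_rw [Real.prod_exp_neg_mul_pow]
  rw [integral_exp_neg_sum_sq_multivariateGaussian hS (l := fun i => κ * m i)
    (fun i => by positivity)]

/-- Taking the two blocks from independent copies realizes the endpoint `τ = 0`. -/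
theorem ProbabilityTheory.integral_prod_eval_multivariateGaussian_prod {S : Matrix ι ι ℝ}
    (hS : S.PosSemidef) (P : ι → Prop) [DecidablePred P] {κ : ℝ} (hκ : 0 ≤ κ) (p : ℝ[X]) :
    ∫ z, ∏ i, p.eval (Real.exp (-(κ * (if P i then z.1 i else z.2 i) ^ 2) / 2))
        ∂((multivariateGaussian 0 S).prod (multivariateGaussian 0 S)) =
      ∑ m ∈ Fintype.piFinset fun _ : ι => Finset.range (p.natDegree + 1),
        (∏ i, p.coeff (m i)) *
          (√(1 + diagonal (fun i => κ * m i) * S.offBlockScale P 0).det)⁻¹ := by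
  have hmeas : ∀ i, Measurable fun z : EuclideanSpace ℝ ι × EuclideanSpace ℝ ι =>
      if P i then z.1 i else z.2 i := by
    intro i; by_cases hi : P i <;> simp only [hi, if_true, if_false] <;> fun_prop
  rw [integral_prod_eval_polynomial _ (q := fun _ => p) (N := p.natDegree + 1)
    (t := fun (z : EuclideanSpace ℝ ι × EuclideanSpace ℝ ι) i =>
      Real.exp (-(κ * (if P i then z.1 i else z.2 i) ^ 2) / 2))
    (fun _ => Nat.lt_succ_self _) (by fun_prop) (fun _ _ => (Real.exp_pos _).le)
    (fun _ _ => Real.exp_neg_mul_div_two_le_one hκ (sq_nonneg _))]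
  refine Finset.sum_congr rfl fun m _ => ?_
  congr 1
  have hl : ∀ i, 0 ≤ κ * m i := fun i => by positivity
  have h₁ : ∀ i, 0 ≤ if P i then κ * m i else 0 := fun i => by split_ifs <;> simp [hl]
  have h₂ : ∀ i, 0 ≤ if P i then 0 else κ * m i := fun i => by split_ifs <;> simp [hl]
  rw [det_one_add_diagonal_mul_offBlockScale_zero,
    Real.sqrt_mul (hS.det_one_add_diagonal_mul_pos h₁).le, mul_inv,
    ← integral_exp_neg_sum_sq_multivariateGaussian hS h₁,
    ← integral_exp_neg_sum_sq_multivariateGaussian hS h₂, ← integral_prod_mul]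
  refine integral_congr_ae (Filter.Eventually.of_forall fun z => ?_)
  simp only [Real.prod_exp_neg_mul_pow]
  rw [← Real.exp_add, ← add_div, ← neg_add, ← Finset.sum_add_distrib]
  congr 3
  refine Finset.sum_congr rfl fun i _ => ?_
  split_ifs <;> simp

/-- Correlation inequality for products of nondecreasing polynomials in `exp (-κ x² / 2)`. -/
theorem ProbabilityTheory.integral_prod_eval_multivariateGaussian_prod_le {S : Matrix ι ι ℝ}
    (hS : S.PosSemidef) (P : ι → Prop) [DecidablePred P] {κ : ℝ} (hκ : 0 ≤ κ) {p : ℝ[X]}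
    (hp : ∀ t ∈ Set.Icc (0 : ℝ) 1, 0 ≤ p.eval t)
    (hp' : ∀ t ∈ Set.Icc (0 : ℝ) 1, 0 ≤ (derivative p).eval t) :
    ∫ z, ∏ i, p.eval (Real.exp (-(κ * (if P i then z.1 i else z.2 i) ^ 2) / 2))
        ∂((multivariateGaussian 0 S).prod (multivariateGaussian 0 S)) ≤
      ∫ x, ∏ i, p.eval (Real.exp (-(κ * x i ^ 2) / 2)) ∂(multivariateGaussian 0 S) := by
  set I := Fintype.piFinset fun _ : ι => Finset.range (p.natDegree + 1)
  set D : (ι → ℕ) → ℝ → ℝ := fun m τ =>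
    (1 + diagonal (fun i => κ * m i) * S.offBlockScale P τ).det with hD
  set G : ℝ → ℝ := fun τ => ∑ m ∈ I, (∏ i, p.coeff (m i)) * (√(D m τ))⁻¹ with hG
  have hpos : ∀ m, ∀ τ ∈ Set.Icc (0 : ℝ) 1, 0 < D m τ := fun m τ hτ =>
    (hS.offBlockScale P (by linarith [hτ.1]) hτ.2).det_one_add_diagonal_mul_pos
      fun i => by positivity
  set c' : Finset ι → ℝ → ℝ := fun J => deriv fun τ => (S.offBlockScale P τ).principalMinor J
  have hDderiv : ∀ m τ, HasDerivAt (D m) (∑ J, (∏ i ∈ J, κ * m i) * c' J τ) τ := by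
    intro m τ
    simp only [hD, det_one_add_diagonal_mul]
    exact HasDerivAt.fun_sum fun J _ =>
      ((differentiable_principalMinor_offBlockScale P S J τ).hasDerivAt).const_mul _
  have hGderiv : ∀ τ ∈ Set.Icc (0 : ℝ) 1, HasDerivAt G
      (∑ m ∈ I, (∏ i, p.coeff (m i)) *
        (-(1 / 2) * (∑ J, (∏ i ∈ J, κ * m i) * c' J τ) * (√(D m τ))⁻¹ ^ 3)) τ := fun τ hτ =>
    HasDerivAt.fun_sum fun m _ =>
      (hasDerivAt_inv_sqrt (hDderiv m τ) (hpos m τ hτ)).const_mul _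
  have hmono : MonotoneOn G (Set.Icc 0 1) := by
    refine monotoneOn_of_deriv_nonneg (convex_Icc 0 1)
      (fun τ hτ => (hGderiv τ hτ).continuousAt.continuousWithinAt)
      (fun τ hτ => (hGderiv τ (interior_subset hτ)).differentiableAt.differentiableWithinAt)
      fun τ hτ => ?_
    have hτ' := interior_subset hτ
    rw [interior_Icc] at hτ
    rw [(hGderiv τ hτ').deriv]
    -- Coefficients of `p` may be negative, so single terms have no sign; only the sum over `m` for
    -- fixed `J` does.
    have e : (∑ m ∈ I, (∏ i, p.coeff (m i)) *
        (-(1 / 2) * (∑ J, (∏ i ∈ J, κ * m i) * c' J τ) * (√(D m τ))⁻¹ ^ 3)) =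
        ∑ J, (-(1 / 2) * c' J τ) *
          ∑ m ∈ I, (∏ i, p.coeff (m i)) * (∏ i ∈ J, κ * m i) * (√(D m τ))⁻¹ ^ 3 := by
      simp_rw [Finset.mul_sum, Finset.sum_mul, Finset.mul_sum]
      rw [Finset.sum_comm]
      exact Finset.sum_congr rfl fun J _ => Finset.sum_congr rfl fun m _ => by ring
    rw [e]
    refine Finset.sum_nonneg fun J _ => mul_nonneg ?_ ?_
    · have := hS.deriv_principalMinor_offBlockScale_nonpos P J hτ
      simp only [c']; linarith
    · exact sum_coeff_mul_laplace_cube_nonneg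
        (hS.offBlockScale P (by linarith [hτ'.1]) hτ'.2) hκ hp hp' J
  have h := hmono (Set.left_mem_Icc.2 zero_le_one) (Set.right_mem_Icc.2 zero_le_one) zero_le_one
  rw [integral_prod_eval_multivariateGaussian_prod hS P hκ,
    integral_prod_eval_multivariateGaussian hS hκ]
  simpa only [hG, hD, offBlockScale_one] using h

end Interpolation

/-! ### From polynomials to indicators, and from measures to random vectors. -/

section Limit
open Matrix WithLp Polynomial Filter Topology

/-- On `[0, 1]` these polynomials increase from `0` to `1`, and they converge to the indicator
function of `[1/2, 1]`. -/
noncomputable def Polynomial.halfStep (n : ℕ) : ℝ[X] := 1 - (1 - X ^ n) ^ (n * 2 ^ n)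

theorem Polynomial.eval_halfStep (n : ℕ) (t : ℝ) :
    (halfStep n).eval t = 1 - (1 - t ^ n) ^ (n * 2 ^ n) := by
  simp [halfStep]

theorem Polynomial.eval_halfStep_mem (n : ℕ) {t : ℝ} (ht : t ∈ Set.Icc (0 : ℝ) 1) :
    (halfStep n).eval t ∈ Set.Icc (0 : ℝ) 1 := by
  have h₀ := pow_nonneg ht.1 n
  have h₁ := pow_le_one₀ ht.1 ht.2 (n := n)
  have h₂ : 0 ≤ (1 - t ^ n) ^ (n * 2 ^ n) := pow_nonneg (by linarith) _
  have h₃ : (1 - t ^ n) ^ (n * 2 ^ n) ≤ 1 := pow_le_one₀ (by linarith) (by linarith)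
  rw [eval_halfStep]
  constructor <;> linarith

theorem Polynomial.eval_derivative_halfStep_nonneg (n : ℕ) {t : ℝ} (ht : t ∈ Set.Icc (0 : ℝ) 1) :
    0 ≤ (derivative (halfStep n)).eval t := by
  have h₁ := pow_le_one₀ ht.1 ht.2 (n := n)
  have h₂ : 0 ≤ 1 - t ^ n := by linarith
  have h₃ := ht.1
  have e : (derivative (halfStep n)).eval t =
      (n * 2 ^ n : ℕ) * (1 - t ^ n) ^ (n * 2 ^ n - 1) * (n * t ^ (n - 1)) := by
    simp [halfStep, derivative_pow]
  rw [e]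
  positivity

/-- The size of `n * 2 ^ n * t ^ n = n * (2 * t) ^ n` decides the limit. It tends to `0` for `t <
1/2` (Bernoulli's inequality), and is at least `n` for `t ≥ 1/2`; the extra factor `n` puts the
endpoint `1/2` on the side of limit `1`. -/
theorem Polynomial.tendsto_eval_halfStep {t : ℝ} (ht : t ∈ Set.Icc (0 : ℝ) 1) :
    Tendsto (fun n => (halfStep n).eval t) atTop (𝓝 (if 1 / 2 ≤ t then 1 else 0)) := by
  simp only [eval_halfStep]
  split_ifs with h
  · have key : Tendsto (fun n : ℕ => (1 - t ^ n) ^ (n * 2 ^ n)) atTop (𝓝 0) := by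
      have hexp : Tendsto (fun n : ℕ => Real.exp (-(n : ℝ))) atTop (𝓝 0) :=
        Real.tendsto_exp_neg_atTop_nhds_zero.comp tendsto_natCast_atTop_atTop
      refine squeeze_zero (fun n => pow_nonneg ?_ _) (fun n => ?_) hexp
      · linarith [pow_le_one₀ ht.1 ht.2 (n := n)]
      · have h₁ : 1 - t ^ n ≤ Real.exp (-(t ^ n)) := by
          linarith [Real.add_one_le_exp (-(t ^ n))]
        have h₀ : 0 ≤ 1 - t ^ n := by linarith [pow_le_one₀ ht.1 ht.2 (n := n)]
        refine (pow_le_pow_left₀ h₀ h₁ _).trans ?_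
        rw [← Real.exp_nat_mul, Real.exp_le_exp]
        have h₂ : 1 ≤ (2 * t) ^ n := one_le_pow₀ (by linarith)
        rw [mul_pow] at h₂
        push_cast
        have h₃ := mul_le_mul_of_nonneg_left h₂ (Nat.cast_nonneg (α := ℝ) n)
        linarith
    simpa using key.const_sub 1
  · have h2 : 2 * t < 1 := by linarith [not_le.1 h]
    have hlim : Tendsto (fun n : ℕ => (n : ℝ) * (2 * t) ^ n) atTop (𝓝 0) :=
      tendsto_self_mul_const_pow_of_lt_one (by linarith [ht.1]) h2
    refine squeeze_zero (fun n => ?_) (fun n => ?_) hlim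
    · have := (eval_halfStep_mem n ht).1
      rwa [eval_halfStep] at this
    · have h₁ := pow_le_one₀ ht.1 ht.2 (n := n)
      have := one_add_mul_le_pow (a := -(t ^ n)) (by linarith) (n * 2 ^ n)
      rw [← sub_eq_add_neg] at this
      push_cast at this
      rw [mul_pow]
      linarith

/-- This fixes `κ = 2 log 2`: the exponential is then `2 ^ (-x ^ 2)`. -/
theorem Real.half_le_exp_neg_iff (x : ℝ) :
    1 / 2 ≤ Real.exp (-(2 * Real.log 2 * x ^ 2) / 2) ↔ |x| ≤ 1 := by
  rw [← Real.log_le_iff_le_exp (by norm_num), ← sq_le_one_iff_abs_le_one, one_div, Real.log_inv]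
  have h := Real.log_pos (one_lt_two (α := ℝ))
  constructor <;> intro hx <;> nlinarith

variable {ι : Type*} [Fintype ι]

theorem MeasureTheory.tendsto_integral_prod_eval_halfStep {α : Type*} [MeasurableSpace α]
    (μ : Measure α) [IsFiniteMeasure μ] {w : α → ι → ℝ} (hw : Measurable w) :
    Tendsto (fun n => ∫ a, ∏ i, (halfStep n).eval
        (Real.exp (-(2 * Real.log 2 * w a i ^ 2) / 2)) ∂μ) atTop
      (𝓝 (μ.real {a | ∀ i, |w a i| ≤ 1})) := by
  have hs : MeasurableSet {a | ∀ i, |w a i| ≤ 1} := by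
    rw [Set.ofPred_forall]
    exact MeasurableSet.iInter fun i => measurableSet_le (by fun_prop) measurable_const
  have ht : ∀ a i, Real.exp (-(2 * Real.log 2 * w a i ^ 2) / 2) ∈ Set.Icc (0 : ℝ) 1 := fun a i =>
    ⟨(Real.exp_pos _).le, Real.exp_neg_mul_div_two_le_one
      (by have := Real.log_pos (one_lt_two (α := ℝ)); linarith) (sq_nonneg _)⟩
  rw [← integral_indicator_one hs]
  refine tendsto_integral_of_dominated_convergence (fun _ => 1) (fun n => ?_)
    (integrable_const _) (fun n => Eventually.of_forall fun a => ?_)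
    (Eventually.of_forall fun a => ?_)
  · simp only [eval_halfStep]
    exact Measurable.aestronglyMeasurable (by fun_prop)
  · have h₀ := fun i (_ : i ∈ Finset.univ) => (eval_halfStep_mem n (ht a i)).1
    rw [Real.norm_of_nonneg (Finset.prod_nonneg h₀)]
    exact Finset.prod_le_one h₀ fun i _ => (eval_halfStep_mem n (ht a i)).2
  · have h := tendsto_finsetProd Finset.univ fun i _ => tendsto_eval_halfStep (ht a i)
    simp only [Real.half_le_exp_neg_iff] at h
    convert! h using 2
    simp [Set.indicator_apply, Finset.prod_ite_zero]

variable [DecidableEq ι]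

/-- Gaussian correlation inequality for the two groups of coordinates given by `P`. -/
theorem ProbabilityTheory.multivariateGaussian_mul_le {S : Matrix ι ι ℝ} (hS : S.PosSemidef)
    (P : ι → Prop) :
    multivariateGaussian 0 S {x | ∀ i, P i → |x i| ≤ 1} *
        multivariateGaussian 0 S {x | ∀ i, ¬ P i → |x i| ≤ 1} ≤
      multivariateGaussian 0 S {x | ∀ i, |x i| ≤ 1} := by
  classical
  set μ := multivariateGaussian 0 S
  have hmeas : Measurable fun (z : EuclideanSpace ℝ ι × EuclideanSpace ℝ ι) i =>
      if P i then z.1 i else z.2 i := by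
    refine measurable_pi_iff.2 fun i => ?_
    by_cases hi : P i <;> simp only [hi, if_true, if_false] <;> fun_prop
  have hκ : 0 ≤ 2 * Real.log 2 := by
    have := Real.log_pos (one_lt_two (α := ℝ)); linarith
  have hle := le_of_tendsto_of_tendsto' (tendsto_integral_prod_eval_halfStep (μ.prod μ) hmeas)
    (tendsto_integral_prod_eval_halfStep μ (w := fun x : EuclideanSpace ℝ ι => ofLp x)
      (by fun_prop)) fun n => integral_prod_eval_multivariateGaussian_prod_le hS P hκ
        (fun t ht => (eval_halfStep_mem n ht).1) fun t ht => eval_derivative_halfStep_nonneg n ht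
  have hset : {z : EuclideanSpace ℝ ι × EuclideanSpace ℝ ι |
      ∀ i, |if P i then z.1 i else z.2 i| ≤ 1} =
      {x | ∀ i, P i → |x i| ≤ 1} ×ˢ {x | ∀ i, ¬ P i → |x i| ≤ 1} := by
    ext z
    simp only [Set.mem_ofPred_eq, Set.mem_prod]
    refine ⟨fun h => ⟨fun i hi => by simpa [hi] using h i, fun i hi => by simpa [hi] using h i⟩,
      fun h i => ?_⟩
    split_ifs with hi
    exacts [h.1 i hi, h.2 i hi]
  rw [hset] at hle
  rw [← Measure.prod_prod]
  exact (ENNReal.toReal_le_toReal (measure_ne_top _ _) (measure_ne_top _ _)).1 hle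

/-- A Gaussian law is determined by its mean and covariance; `S` is the covariance form in the
standard basis and may be singular. -/
theorem ProbabilityTheory.HasGaussianLaw.map_toLp_eq_multivariateGaussian {Ω : Type*}
    [MeasurableSpace Ω] {P : Measure Ω} {X : Ω → ι → ℝ} (hX : HasGaussianLaw X P)
    (hX₀ : ∀ i, ∫ ω, X ω i ∂P = 0) :
    ∃ S : Matrix ι ι ℝ, S.PosSemidef ∧
      P.map (fun ω => toLp 2 (X ω)) = multivariateGaussian 0 S := by
  have : IsProbabilityMeasure P := hX.isProbabilityMeasure
  have hY : HasGaussianLaw (fun ω => toLp 2 (X ω)) P :=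
    hX.map_equiv_fun (PiLp.continuousLinearEquiv 2 ℝ (fun _ : ι => ℝ)).symm
  have : IsGaussian (P.map fun ω => toLp 2 (X ω)) := hY.isGaussian_map
  set ν := P.map fun ω => toLp 2 (X ω)
  set b := (EuclideanSpace.basisFun ι ℝ)
  let S : Matrix ι ι ℝ := Matrix.of fun i j => covarianceBilin ν (b i) (b j)
  have hquad : ∀ x y : EuclideanSpace ℝ ι, covarianceBilin ν x y = ofLp x ⬝ᵥ S *ᵥ ofLp y := by
    intro x y
    conv_lhs => rw [← b.sum_repr x, ← b.sum_repr y]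
    simp only [map_sum, map_smul, _root_.sum_apply, _root_.smul_apply,
      smul_eq_mul, dotProduct, mulVec, S, of_apply, Finset.mul_sum]
    rw [Finset.sum_comm]
    refine Finset.sum_congr rfl fun i _ => Finset.sum_congr rfl fun j _ => ?_
    simp [b]; ring
  have hS : S.PosSemidef := by
    refine PosSemidef.of_dotProduct_mulVec_nonneg ?_ fun x => ?_
    · ext i j
      simp [S, covarianceBilin_comm]
    · have := covarianceBilin_self_nonneg (μ := ν) (toLp 2 x)
      rw [hquad] at this
      simpa using this
  refine ⟨S, hS, IsGaussian.ext ?_ ?_⟩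
  · rw [integral_id_multivariateGaussian']
    simp only [ν]
    rw [integral_map hY.aemeasurable (by fun_prop)]
    ext i
    have h := (EuclideanSpace.proj (𝕜 := ℝ) i).integral_comp_comm hY.integrable
    simpa [hX₀] using h.symm
  · ext x y
    rw [hquad, covarianceBilin_multivariateGaussian hS]

end Limit

theorem theorem1p1 {Ω : Type*} [MeasurableSpace Ω] (P : Measure Ω) [IsProbabilityMeasure P]
    (n n₁ : ℕ) (hn₁ : 1 ≤ n₁) (hn : n₁ ≤ n)
    (X : Ω → Fin n → ℝ) (hX : HasGaussianLaw X P) (hX₀ : ∀ i : Fin n, ∫ ω, X ω i ∂P = 0) :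
    P {ω | ∀ i : Fin n, |X ω i| ≤ 1} ≥
      P {ω | ∀ i : Fin n, (i : ℕ) < n₁ → |X ω i| ≤ 1} *
        P {ω | ∀ i : Fin n, n₁ ≤ (i : ℕ) → |X ω i| ≤ 1} := by
  obtain ⟨S, hS, hmap⟩ := hX.map_toLp_eq_multivariateGaussian hX₀
  have hY : AEMeasurable (fun ω => WithLp.toLp 2 (X ω)) P := by
    have := hX.aemeasurable; fun_prop
  have hlaw : ∀ Q : Fin n → Prop, P {ω | ∀ i, Q i → |X ω i| ≤ 1} =
      multivariateGaussian 0 S {x | ∀ i, Q i → |x i| ≤ 1} := by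
    intro Q
    rw [← hmap, Measure.map_apply_of_aemeasurable hY]
    · rfl
    · simp only [Set.ofPred_forall]
      exact MeasurableSet.iInter fun i => MeasurableSet.iInter fun _ =>
        measurableSet_le (by fun_prop) measurable_const
  have h := multivariateGaussian_mul_le hS fun i : Fin n => (i : ℕ) < n₁
  have hall := hlaw fun _ => True
  simp only [true_imp_iff] at hall
  rw [hlaw, hlaw, hall]
  simpa only [not_lt] using h
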